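/- Write $\{0,1\}^*$ for the set of finite binary strings and $l(p)$ for the length of $p$. A \emph{prefix machine} is a partial recursive function $T(p,y)$ (program $p\in\{0,1\}^*$, side information $y\in\{0,1\}^*$, output in $\{0,1\}^*$) such that for every $y$ the set of programs $p$ for which $T(p,y)$ is defined is prefix-free. Fix a universal prefix machine $U$: a prefix machine such that for every prefix machine $T$ there is a string $s$ with $U(sp,y)=T(p,y)$ for all $p,y$ (both sides being defined or undefined together). Put $K(x\mid y)=\min\{l(p):U(p,y)=x\}$ and $K(x)=K(x\mid\epsilon)$, let $x^*$ be the lexicographically first among the shortest programs $p$ with $U(p,\epsilon)=x$, and let $I(x:y)=K(y)-K(y\mid x^*)$ be the algorithmic information in $x$ about $y$. A function $f:\{0,1\}^*\times\{0,1\}^*\to\mathbb R$ is \emph{computed} by a program if the program, on input $(x,y)$ and $n\ge 1$, halts and outputs natural numbers $p$, $q\geq 1$ with $|p/q-|f(x,y)||<1/n$, together with a bit indicating the sign of $f(x,y)$ (arbitrary if $f(x,y)=0$); $f$ is \emph{computable} if some program computes it. $K(f)$ is the minimum of $K(i)$ over all indices $i$, in a standard enumeration of the partial recursive functions, of programs that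 compute $f$, where natural numbers are identified with binary strings in length-lexicographic order. For a probability mass function $f$ on pairs, with marginals $f_1(x)=\sum_y f(x,y)$ and $f_2(y)=\sum_x f(x,y)$, let $$I(X;Y)=\sum_{x,y} f(x,y)\log_2\frac{f(x,y)}{f_1(x)f_2(y)}$$ (terms with $f(x,y)=0$ are $0$). \textbf{Theorem.} There is a constant $C$, depending only on $U$, such that for every computable probability mass function $f(x,y)$ on $\{0,1\}^*\times\{0,1\}^*$ the negative terms of the sum defining $I(X;Y)$, and those of the sum $\sum_{x,y}f(x,y)I(x:y)$, have a finite total, so that both sums are well defined in $(-\infty,+\infty]$, and $$I(X;Y)-K(f)\;\le\;\sum_{x,y}f(x,y)\,I(x:y)+C,\qquad \sum_{x,y}f(x,y)\,I(x:y)\;\le\;I(X;Y)+2K(f)+C .$$ -/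

import Mathlib

noncomputable section

namespace AlgInfo

/-- Finite binary strings. -/
abbrev BinStr : Type := List Bool

/-- A prefix machine with side information: `T p y` is the (possibly undefined) output on program
`p` when the string `y` is given for free. It is partial recursive, and for every fixed `y` the set
of halting programs is prefix-free. -/
structure IsPrefixMachine (T : BinStr → BinStr →. BinStr) : Prop where
  partrec : Partrec₂ T
  prefix_free : ∀ y p q : BinStr, (T p y).Dom → (T q y).Dom → p <+: q → p = q

/-- A universal (reference) prefix machine: a prefix machine that simulates every prefix machine `T`
on the programs with a header string `s` identifying `T`. -/
structure IsUniversalPrefixMachine (U : BinStr → BinStr →. BinStr) : Prop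
    extends IsPrefixMachine U where
  simulates : ∀ T : BinStr → BinStr →. BinStr, IsPrefixMachine T →
    ∃ s : BinStr, ∀ p y : BinStr, U (s ++ p) y = T p y

/-- Conditional prefix complexity `K(x | y)` with respect to `U`. For universal `U` the set is
nonempty, so the infimum is a minimum. -/
def condK (U : BinStr → BinStr →. BinStr) (x y : BinStr) : ℕ :=
  sInf {n | ∃ p : BinStr, x ∈ U p y ∧ p.length = n}

/-- Prefix complexity `K(x) = K(x | ε)`. -/
def prefixK (U : BinStr → BinStr →. BinStr) (x : BinStr) : ℕ :=
  condK U x []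

open Classical in
/-- `x*`: the lexicographically first among the shortest programs for `x`, that is, the least
program in the length-lexicographic order. (The default is never used for universal `U`.) -/
def shortestProgram (U : BinStr → BinStr →. BinStr) (x : BinStr) : BinStr :=
  if h : {p : BinStr | x ∈ U p []}.Nonempty then
    (List.Shortlex.wf (r := ((· < ·) : Bool → Bool → Prop)) wellFounded_lt).min
      {p : BinStr | x ∈ U p []} h
  else []

/-- The information `I(x : y) = K(y) - K(y | x*)` in `x` about `y`. -/
def algMutualInfo (U : BinStr → BinStr →. BinStr) (x y : BinStr) : ℝ :=
  (prefixK U y : ℝ) - (condK U y (shortestProgram U x) : ℝ)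

/-- The program `c` computes the real-valued function `f`: on input `⟨⟨x, y⟩, n⟩` with `n ≥ 1` it
halts with output `⟨⟨p, q⟩, b⟩`, where `p / q` is within `1 / n` of `|f (x, y)|` and the bit `b`
indicates the sign of `f (x, y)`. -/
def ComputesReal (c : Nat.Partrec.Code) (f : BinStr × BinStr → ℝ) : Prop :=
  ∀ (z : BinStr × BinStr) (n : ℕ), 0 < n →
    ∃ (p q : ℕ) (b : Bool),
      c.eval (Nat.pair (Encodable.encode z) n) = Part.some (Nat.pair (Nat.pair p q) b.toNat) ∧
      0 < q ∧ |(p : ℝ) / (q : ℝ) - abs (f z)| < 1 / (n : ℝ) ∧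
      (0 < f z → b = true) ∧ (f z < 0 → b = false)

/-- `f` is a computable real-valued function. -/
def IsComputableReal (f : BinStr × BinStr → ℝ) : Prop :=
  ∃ c : Nat.Partrec.Code, ComputesReal c f

/-- The standard identification of `ℕ` with the binary strings in length-lexicographic order
(`0 ↦ ε`, `1 ↦ 0`, `2 ↦ 1`, `3 ↦ 00`, `4 ↦ 01`, …): the binary notation of `n + 1`, most
significant bit first, without its leading `1`. -/
def natToStr (n : ℕ) : BinStr := (Nat.bits (n + 1)).dropLast.reverse

/-- `K(f)`: the least complexity `K(i)` of an index `i` (in the standard enumeration of the partial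
recursive functions) of a program that computes `f`. -/
def funK (U : BinStr → BinStr →. BinStr) (f : BinStr × BinStr → ℝ) : ℕ :=
  sInf {n | ∃ c : Nat.Partrec.Code, ComputesReal c f ∧
    prefixK U (natToStr (Encodable.encode c)) = n}

/-- `f` is a joint probability mass function of a pair of binary strings. -/
def IsJointPMF (f : BinStr × BinStr → ℝ) : Prop :=
  (∀ z, 0 ≤ f z) ∧ HasSum f 1

/-- The marginal `f₁`. -/
def marginalFst (f : BinStr × BinStr → ℝ) (x : BinStr) : ℝ := ∑' y, f (x, y)

/-- The marginal `f₂`. -/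
def marginalSnd (f : BinStr × BinStr → ℝ) (y : BinStr) : ℝ := ∑' x, f (x, y)

/-- The total of the negative parts of `g`. -/
def negTotal (g : BinStr × BinStr → ℝ) : ENNReal := ∑' z, ENNReal.ofReal (-g z)

/-- The sum of `g` over all pairs as an extended real: the total of the positive parts minus the
total of the negative parts. It is meaningful, with a value in `(-∞, ∞]`, when `negTotal g ≠ ⊤`. -/
def extSum (g : BinStr × BinStr → ℝ) : EReal :=
  ((∑' z, ENNReal.ofReal (g z) : ENNReal) : EReal) - ((negTotal g : ENNReal) : EReal)

/-- The term `f(x,y) log₂ (f(x,y) / (f₁(x) f₂(y)))` of the Shannon mutual information. -/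
def shannonTerm (f : BinStr × BinStr → ℝ) (z : BinStr × BinStr) : ℝ :=
  f z * Real.logb 2 (f z / (marginalFst f z.1 * marginalSnd f z.2))

/-- The Shannon mutual information `I(X ; Y)`, in bits, of a pair with distribution `f`. -/
def mutualInfo (f : BinStr × BinStr → ℝ) : EReal := extSum (shannonTerm f)

/-- The term `f(x,y) I(x : y)` of the expected algorithmic mutual information. -/
def algTerm (U : BinStr → BinStr →. BinStr) (f : BinStr × BinStr → ℝ)
    (z : BinStr × BinStr) : ℝ :=
  f z * algMutualInfo U z.1 z.2

/-- The expected algorithmic mutual information `∑ f(x,y) I(x : y)`. -/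
def expectedAlgMutualInfo (U : BinStr → BinStr →. BinStr) (f : BinStr × BinStr → ℝ) : EReal :=
  extSum (algTerm U f)

end AlgInfo

end

/-!
The proof compares the two sums term by term, up to a summable correction. It rests on two coding
bounds and on the Kraft inequality.

Let `c` be a program for `f` with `K(c) = K(f)`. The coding bounds are
`K(y) ≤ -log₂ f₂(y) + K(f) + O(1)` (`prefixK_le_neg_logb_marginalSnd`) and
`K(y | x*) ≤ -log₂ (f(x, y) / f₁(x)) + K(f) + O(1)` (`condK_shortestProgram_le_neg_logb`). Both are
instances of one coding theorem, `condK_le_neg_logb`. The distribution to be coded enters through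
the conditions "`2 ^ (-k)` is less than the probability of `y`", each of which says that some
weighted sum `∑ g z * f z` exceeds `1`, and so is confirmed at a finite stage of computation if it
is true (`exists_verified_iff`). For the conditional distribution this uses that `f` has total mass
one, which turns an upper estimate of `f₁(x)` into a lower estimate of the remaining mass. Each
confirmed condition is a request for an interval of length `2 ^ (-k-1)`. The intervals are laid out
side by side in `[0, 1)`, and a dyadic cell inside an interval is the code word of its request; no
guard against indices of other functions is needed, as code words for intervals beyond `1` do not
exist. The machine `codingMachine` reads a program for `c`, then a code word.

With `2 ^ (-K(y))` and `2 ^ (-K(y | x*))` as semimeasures (`sum_half_pow_condK_le_one`), the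
estimate `log₂ t ≤ (t - 1) / log 2` gives the converse inequalities on average:
`∑ f(x, y) (K(y) + log₂ f₂(y)) ≥ 0`, and `∑ f(x, y) (K(y | x*) + log₂ (f(x, y) / f₁(x))) ≥ 0`.
As `I(x : y) = K(y) - K(y | x*)`, the second coding bound and the first average bound the Shannon
information by the algorithmic one (`mutualInfo_le`), and the first coding bound and the second
average give the opposite inequality (`expectedAlgMutualInfo_le`), with a single `K(f)` each time.
Symmetry of information is not used. Since entropies may be infinite, the comparison is made
pointwise with summable error terms and only then summed (`extSum_le_add`).
-/

namespace AlgInfo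

open Encodable

open Nat.Partrec (Code)

section StringsAndCodewords

/-! ### Binary strings as numbers -/

/-- The number whose binary notation, most significant bit first, is `p` written after the binary
notation of `a`. -/
def bitsValue (a : ℕ) (p : BinStr) : ℕ := p.foldl (fun v b => 2 * v + b.toNat) a

/-- A left inverse of `natToStr`: restore the leading `1`, read in binary, subtract one. -/
def strToNat (p : BinStr) : ℕ := bitsValue 1 p - 1

lemma bitsValue_append (a : ℕ) (p q : BinStr) :
    bitsValue a (p ++ q) = bitsValue (bitsValue a p) q := by
  simp [bitsValue]

lemma bitsValue_mem_Ico (a : ℕ) (p : BinStr) :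
    a * 2 ^ p.length ≤ bitsValue a p ∧ bitsValue a p < (a + 1) * 2 ^ p.length := by
  induction p generalizing a with
  | nil => simp [bitsValue]
  | cons b p ih =>
    have h := ih (2 * a + b.toNat)
    have hb : b.toNat ≤ 1 := Bool.toNat_le b
    have hcons : bitsValue a (b :: p) = bitsValue (2 * a + b.toNat) p := rfl
    rw [hcons, List.length_cons, pow_succ]
    refine ⟨le_trans ?_ h.1, h.2.trans_le ?_⟩
    · calc a * (2 ^ p.length * 2) = (2 * a) * 2 ^ p.length := by ring
        _ ≤ _ := Nat.mul_le_mul_right _ (by omega)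
    · calc _ ≤ (2 * a + 2) * 2 ^ p.length := Nat.mul_le_mul_right _ (by omega)
        _ = _ := by ring

lemma exists_bitsValue_eq (n v : ℕ) (hv : v < 2 ^ n) :
    ∃ p : BinStr, p.length = n ∧ bitsValue 0 p = v := by
  induction n generalizing v with
  | zero => exact ⟨[], rfl, by simp at hv; simp [bitsValue, hv]⟩
  | succ n ih =>
    obtain ⟨p, hp, hpv⟩ := ih (v / 2) (by rw [pow_succ] at hv; omega)
    refine ⟨p ++ [v.bodd], by simp [hp], ?_⟩
    have := Nat.bodd_add_div2 v
    rw [bitsValue_append, hpv, ← Nat.div2_val]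
    simp only [bitsValue, List.foldl_cons, List.foldl_nil]
    cases h : v.bodd <;> simp [h] at this ⊢ <;> omega

lemma foldr_bits_dropLast {n : ℕ} (hn : n ≠ 0) :
    n.bits.dropLast.foldr (fun b v => 2 * v + b.toNat) 1 = n := by
  induction n using Nat.binaryRec' with
  | zero => exact absurd rfl hn
  | bit b n h ih =>
    rw [Nat.bits_append_bit n b h]
    by_cases hn0 : n = 0
    · subst hn0
      have hb := h rfl
      subst hb
      simp [Nat.bit]
    · have hne : n.bits ≠ [] := by
        intro h0
        have := Nat.size_eq_bits_len n
        rw [h0] at this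
        exact hn0 (Nat.size_eq_zero.1 this.symm)
      rw [List.dropLast_cons_of_ne_nil hne, List.foldr_cons, ih hn0]
      cases b <;> simp [Nat.bit]

lemma strToNat_natToStr (n : ℕ) : strToNat (natToStr n) = n := by
  simp [strToNat, natToStr, bitsValue, foldr_bits_dropLast]

lemma primrec_bitsValue (a : ℕ) : Primrec (bitsValue a) :=
  Primrec.list_foldl Primrec.id (Primrec.const a)
    (Primrec.nat_add.comp
      (Primrec.nat_mul.comp (Primrec.const 2) (Primrec.fst.comp Primrec.snd))
      ((Primrec.dom_bool Bool.toNat).comp (Primrec.snd.comp Primrec.snd))).to₂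

lemma primrec_strToNat : Primrec strToNat :=
  Primrec.nat_sub.comp (primrec_bitsValue 1) (Primrec.const 1)

/-! ### Allocating code words to a stream of requests -/

/-- The total length of the intervals requested before time `j`, when the granted request `i` asks
for an interval of length `2 ^ (-len i)`. -/
noncomputable def allocated (req : ℕ → Prop) (len : ℕ → ℕ) (j : ℕ) : ℝ :=
  open Classical in ∑ i ∈ Finset.range j, if req i then (1 / 2 : ℝ) ^ len i else 0

/-- `allocated req len j` scaled by `2 ^ j`, a natural number provided that `len i ≤ i + 1`. -/
noncomputable def allocatedScaled (req : ℕ → Prop) (len : ℕ → ℕ) (j : ℕ) : ℕ :=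
  open Classical in ∑ i ∈ Finset.range j, if req i then 2 ^ (j - len i) else 0

/-- `q` is the code word of the granted request `j`. The intervals of the requests are laid out
side by side, and `q` names the first dyadic cell of half the length that starts strictly inside
the interval of `j`. -/
def IsCodeword (req : ℕ → Prop) (len : ℕ → ℕ) (j : ℕ) (q : BinStr) : Prop :=
  req j ∧ q.length = len j + 1 ∧
    bitsValue 0 q = allocatedScaled req len j * 2 ^ (len j + 1) / 2 ^ j + 1

variable {req : ℕ → Prop} {len : ℕ → ℕ}

lemma allocatedScaled_eq (hlen : ∀ i, len i ≤ i + 1) (j : ℕ) :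
    (allocatedScaled req len j : ℝ) = allocated req len j * 2 ^ j := by
  classical
  rw [allocatedScaled, allocated, Finset.sum_mul]
  push_cast
  refine Finset.sum_congr rfl fun i hi => ?_
  have h1 : len i ≤ j := (hlen i).trans (Finset.mem_range.1 hi)
  split_ifs
  · rw [pow_sub₀ _ two_ne_zero h1, one_div, inv_pow, mul_comm]
  · simp

lemma allocated_mono : Monotone (allocated req len) := by
  classical
  refine monotone_nat_of_le_succ fun j => ?_
  rw [allocated, allocated, Finset.sum_range_succ]
  have : (0 : ℝ) ≤ if req j then (1 / 2 : ℝ) ^ len j else 0 := by split_ifs <;> positivity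
  linarith

lemma allocated_succ {j : ℕ} (hj : req j) :
    allocated req len (j + 1) = allocated req len j + (1 / 2) ^ len j := by
  classical
  simp [allocated, Finset.sum_range_succ, hj]

/-- The cell named by a code word lies in the interval of its request. Scaled by `2 ^ (len j + 1)`,
the interval has length two, so it contains the unit cell that starts after the next integer. -/
lemma codeword_cell (hlen : ∀ i, len i ≤ i + 1) (j : ℕ) :
    let m := allocatedScaled req len j * 2 ^ (len j + 1) / 2 ^ j + 1
    allocated req len j * 2 ^ (len j + 1) < m ∧
      ((m : ℝ) + 1) ≤ (allocated req len j + (1 / 2) ^ len j) * 2 ^ (len j + 1) := by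
  intro m
  have h1 : ((allocatedScaled req len j * 2 ^ (len j + 1) : ℕ) : ℝ) / ((2 ^ j : ℕ) : ℝ)
      = allocated req len j * 2 ^ (len j + 1) := by
    push_cast
    rw [allocatedScaled_eq hlen]
    field_simp
  have hm : m = ⌊allocated req len j * 2 ^ (len j + 1)⌋₊ + 1 := by
    rw [← h1, Nat.floor_div_eq_div]
  have h0 : 0 ≤ allocated req len j * 2 ^ (len j + 1) := by rw [← h1]; positivity
  have h2 := Nat.lt_floor_add_one (allocated req len j * 2 ^ (len j + 1))
  have h3 := Nat.floor_le h0
  have h4 : ((1 / 2 : ℝ) ^ len j) * 2 ^ (len j + 1) = 2 := by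
    rw [pow_succ, ← mul_assoc, ← mul_pow]; norm_num
  rw [hm, add_mul, h4]
  push_cast
  exact ⟨h2, by linarith⟩

lemma exists_codeword (hlen : ∀ i, len i ≤ i + 1) {j : ℕ} (hj : req j)
    (hS : allocated req len (j + 1) ≤ 1) : ∃ q, IsCodeword req len j q := by
  obtain ⟨-, h2⟩ := codeword_cell (req := req) hlen j
  rw [← allocated_succ hj] at h2
  have h3 : (((allocatedScaled req len j * 2 ^ (len j + 1) / 2 ^ j + 1 : ℕ) : ℝ) + 1)
      ≤ ((2 ^ (len j + 1) : ℕ) : ℝ) := by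
    refine h2.trans ?_
    push_cast
    exact mul_le_of_le_one_left (by positivity) hS
  obtain ⟨q, hq, hqv⟩ := exists_bitsValue_eq (len j + 1)
    (allocatedScaled req len j * 2 ^ (len j + 1) / 2 ^ j + 1) (by exact_mod_cast h3)
  exact ⟨q, hj, hq, hqv⟩

/-- Code words of distinct requests are incomparable, because the requests own disjoint intervals;
the total length of the intervals does not matter here. -/
lemma IsCodeword.eq_of_prefix (hlen : ∀ i, len i ≤ i + 1) {j j' : ℕ} {q q' : BinStr}
    (h : IsCodeword req len j q) (h' : IsCodeword req len j' q') (hqq : q <+: q') :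
    j = j' ∧ q = q' := by
  obtain ⟨r, rfl⟩ := hqq
  have hr := bitsValue_mem_Ico (bitsValue 0 q) r
  obtain ⟨a1, a2⟩ := codeword_cell (req := req) hlen j
  obtain ⟨b1, b2⟩ := codeword_cell (req := req) hlen j'
  rw [← h.2.2] at a1 a2
  rw [← h'.2.2, bitsValue_append] at b1 b2
  rw [← allocated_succ h.1] at a2
  rw [← allocated_succ h'.1] at b2
  have hl' : len j' + 1 = (len j + 1) + r.length := by
    rw [← h'.2.1, ← h.2.1, List.length_append]
  rw [hl', pow_add] at b1 b2
  have hr1 : (bitsValue 0 q : ℝ) * 2 ^ r.length ≤ bitsValue (bitsValue 0 q) r := by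
    exact_mod_cast hr.1
  have hr2 : (bitsValue (bitsValue 0 q) r : ℝ) + 1 ≤ (bitsValue 0 q + 1) * 2 ^ r.length := by
    exact_mod_cast hr.2
  have hP : (0 : ℝ) < 2 ^ (len j + 1) := by positivity
  have hR : (0 : ℝ) < 2 ^ r.length := by positivity
  -- The cell of `q ++ r` lies in the cell of `q`, so the two intervals overlap.
  have hlt1 : allocated req len j < allocated req len (j' + 1) := by
    by_contra hcon
    push Not at hcon
    have := mul_le_mul_of_nonneg_right hcon (mul_pos hP hR).le
    have := mul_lt_mul_of_pos_right a1 hR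
    nlinarith
  have hlt2 : allocated req len j' < allocated req len (j + 1) := by
    by_contra hcon
    push Not at hcon
    have := mul_le_mul_of_nonneg_right hcon (mul_pos hP hR).le
    have := mul_le_mul_of_nonneg_right a2 hR.le
    nlinarith
  have e1 : j < j' + 1 := allocated_mono.reflect_lt hlt1
  have e2 : j' < j + 1 := allocated_mono.reflect_lt hlt2
  have e : j = j' := by omega
  subst e
  have : r.length = 0 := by omega
  refine ⟨rfl, by rw [List.length_eq_zero_iff.1 this, List.append_nil]⟩

end StringsAndCodewords

section CodingMachine

/-! ### Requests extracted from a program for a probability mass function -/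

/-- A string read off from its code number. -/
def decodeStr (n : ℕ) : BinStr := (decode n).getD []

/-- The number `a` such that `a / M` is the lower estimate of `|f z|`, at precision `M` and within
`u` steps of computation, that the program with index `c` provides on the code number `n` of `z`.
It is `0` as long as the program has not halted. -/
def lowerEstimate (c n M u : ℕ) : ℕ :=
  ((Code.evaln u (Denumerable.ofNat Code c) (Nat.pair n M)).map
    fun v => M * v.unpair.1.unpair.1 / v.unpair.1.unpair.2 - 1).getD 0

/-- A weight on pairs of strings as a weight on code numbers, zero outside the range of `encode`. -/
def codeWeight (g : BinStr × BinStr → ℕ) (n : ℕ) : ℕ :=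
  ((decode₂ (BinStr × BinStr) n).map g).getD 0

/-- At stage `t = ⟨M, u, N⟩` it has been seen that `∑ g z * f z > 1`, where `f` is computed by the
program with index `c`: precision `M` and `u` steps of computation on the code numbers below `N`
suffice to see it. -/
def Verified (c : ℕ) (g : BinStr × BinStr → ℕ) (t : ℕ) : Prop :=
  t.unpair.1 < ∑ n ∈ Finset.range t.unpair.2.unpair.2,
    codeWeight g n * lowerEstimate c n t.unpair.1 t.unpair.2.unpair.1

/-- The request `j = ⟨y, k, t⟩` is granted if `t` is the first stage at which the condition
`∑ G (x, y, k) z * f z > 1` is verified. -/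
def Request (G : BinStr × BinStr × ℕ → BinStr × BinStr → ℕ) (c : ℕ) (x : BinStr) (j : ℕ) : Prop :=
  encode (decodeStr j.unpair.1) = j.unpair.1 ∧
    Verified c (G (x, decodeStr j.unpair.1, j.unpair.2.unpair.1)) j.unpair.2.unpair.2 ∧
    ∀ t < j.unpair.2.unpair.2, ¬ Verified c (G (x, decodeStr j.unpair.1, j.unpair.2.unpair.1)) t

/-- The length `k + 1` asked for by the request `⟨y, k, t⟩`. -/
def requestLen (j : ℕ) : ℕ := j.unpair.2.unpair.1 + 1

lemma requestLen_le (j : ℕ) : requestLen j ≤ j + 1 := by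
  have h1 := Nat.unpair_left_le j.unpair.2
  have h2 := Nat.unpair_right_le j
  simp only [requestLen]
  omega

section Primrec

variable {α : Type} [Primcodable α]

lemma primrec_sum_range {f : α → ℕ → ℕ} {N : α → ℕ} (hf : Primrec₂ f) (hN : Primrec N) :
    Primrec fun a => ∑ i ∈ Finset.range (N a), f a i := by
  refine (Primrec.nat_rec' (h := fun a p => p.2 + f a p.1) hN (Primrec.const 0) ?_).of_eq
    fun a => ?_
  · exact Primrec.nat_add.comp (Primrec.snd.comp Primrec.snd)
      (hf.comp Primrec.fst (Primrec.fst.comp Primrec.snd))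
  · induction N a with
    | zero => simp
    | succ n ih => simp only [Finset.sum_range_succ, ← ih]

lemma primrec_two_pow : Primrec fun n : ℕ => 2 ^ n := by
  refine (Primrec.nat_rec₁ (f := fun _ v => 2 * v) 1
    (Primrec.nat_mul.comp (Primrec.const 2) Primrec.snd).to₂).of_eq fun n => ?_
  induction n with
  | zero => rfl
  | succ n ih => exact (congrArg (2 * ·) ih).trans (pow_succ' 2 n).symm

lemma primrec_unpair_fst {f : α → ℕ} (hf : Primrec f) : Primrec fun a => (f a).unpair.1 :=
  Primrec.fst.comp (Primrec.unpair.comp hf)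

lemma primrec_unpair_snd {f : α → ℕ} (hf : Primrec f) : Primrec fun a => (f a).unpair.2 :=
  Primrec.snd.comp (Primrec.unpair.comp hf)

lemma primrec_decodeStr : Primrec decodeStr :=
  Primrec.option_getD.comp Primrec.decode (Primrec.const [])

lemma primrec_lowerEstimate {c n M u : α → ℕ} (hc : Primrec c) (hn : Primrec n) (hM : Primrec M)
    (hu : Primrec u) : Primrec fun a => lowerEstimate (c a) (n a) (M a) (u a) := by
  refine Primrec.option_getD.comp (Primrec.option_map
    (Code.primrec_evaln.comp (Primrec.pair (Primrec.pair hu ((Primrec.ofNat Code).comp hc))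
      (Primrec₂.natPair.comp hn hM))) ?_) (Primrec.const 0)
  have hv : Primrec fun p : α × ℕ => p.2.unpair.1 := primrec_unpair_fst Primrec.snd
  exact (Primrec.nat_sub.comp (Primrec.nat_div.comp
    (Primrec.nat_mul.comp (hM.comp Primrec.fst) (primrec_unpair_fst hv))
    (primrec_unpair_snd hv)) (Primrec.const 1)).to₂

lemma primrec_codeWeight {β : Type} [Primcodable β] {G : β → BinStr × BinStr → ℕ}
    (hG : Primrec₂ G) {b : α → β} {n : α → ℕ} (hb : Primrec b) (hn : Primrec n) :
    Primrec fun a => codeWeight (G (b a)) (n a) :=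
  Primrec.option_getD.comp (Primrec.option_map (Primrec.decode₂.comp hn)
    (hG.comp (hb.comp Primrec.fst) Primrec.snd).to₂) (Primrec.const 0)

lemma primrecPred_verified {β : Type} [Primcodable β] {G : β → BinStr × BinStr → ℕ}
    (hG : Primrec₂ G) {c t : α → ℕ} {b : α → β} (hc : Primrec c) (hb : Primrec b)
    (ht : Primrec t) : PrimrecPred fun a => Verified (c a) (G (b a)) (t a) := by
  have ht2 := primrec_unpair_snd ht
  refine Primrec.nat_lt.comp (primrec_unpair_fst ht)
    (primrec_sum_range (Primrec₂.mk (Primrec.nat_mul.comp ?_ ?_)) (primrec_unpair_snd ht2))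
  · exact primrec_codeWeight hG (hb.comp Primrec.fst) Primrec.snd
  · exact primrec_lowerEstimate (hc.comp Primrec.fst) Primrec.snd
      ((primrec_unpair_fst ht).comp Primrec.fst) ((primrec_unpair_fst ht2).comp Primrec.fst)

lemma primrec_requestLen {j : α → ℕ} (hj : Primrec j) : Primrec fun a => requestLen (j a) :=
  Primrec.succ.comp (primrec_unpair_fst (primrec_unpair_snd hj))

variable {G : BinStr × BinStr × ℕ → BinStr × BinStr → ℕ}

lemma primrecPred_request (hG : Primrec₂ G) {c j : α → ℕ} {x : α → BinStr} (hc : Primrec c)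
    (hx : Primrec x) (hj : Primrec j) : PrimrecPred fun a => Request G (c a) (x a) (j a) := by
  have h1 := primrec_unpair_fst hj
  have h2 := primrec_unpair_snd hj
  have hy := primrec_decodeStr.comp h1
  have hb := Primrec.pair hx (Primrec.pair hy (primrec_unpair_fst h2))
  refine (Primrec.eq.comp (Primrec.encode.comp hy) h1).and
    ((primrecPred_verified hG hc hb (primrec_unpair_snd h2)).and ?_)
  have hR : PrimrecRel fun (t : ℕ) (a : α) => ¬ Verified (c a)
      (G (x a, decodeStr (j a).unpair.1, (j a).unpair.2.unpair.1)) t :=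
    (primrecPred_verified (α := ℕ × α) hG (hc.comp Primrec.snd) (hb.comp Primrec.snd)
      Primrec.fst).not
  exact (hR.forall_mem_list.comp (Primrec.list_range.comp (primrec_unpair_snd h2))
    Primrec.id).of_eq fun a => by simp

lemma primrecPred_isCodeword (hG : Primrec₂ G) {c j : α → ℕ} {x q : α → BinStr} (hc : Primrec c)
    (hx : Primrec x) (hj : Primrec j) (hq : Primrec q) :
    PrimrecPred fun a => IsCodeword (Request G (c a) (x a)) requestLen (j a) (q a) := by
  classical
  have hl := Primrec.succ.comp (primrec_requestLen hj)
  have hS : Primrec fun a => allocatedScaled (Request G (c a) (x a)) requestLen (j a) := by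
    refine primrec_sum_range (Primrec₂.mk ?_) hj
    refine Primrec.ite (primrecPred_request hG (hc.comp Primrec.fst) (hx.comp Primrec.fst)
      Primrec.snd) (primrec_two_pow.comp (Primrec.nat_sub.comp (hj.comp Primrec.fst)
        (primrec_requestLen Primrec.snd))) (Primrec.const 0)
  exact (primrecPred_request hG hc hx hj).and ((Primrec.eq.comp (Primrec.list_length.comp hq)
    hl).and (Primrec.eq.comp ((primrec_bitsValue 0).comp hq) (Primrec.succ.comp
      (Primrec.nat_div.comp (Primrec.nat_mul.comp hS (primrec_two_pow.comp hl))
        (primrec_two_pow.comp hj)))))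

end Primrec

/-! ### The coding machine -/

/-- The search condition of the coding machine on program `p` and side information `s`: for the
witness `w = ⟨n, u, j⟩`, the program `cU` of the universal machine turns the first `n` bits of `p`
into an index `c` within `u` steps, the program `cH` turns the side information into a string `x`
within `u` steps, and the rest of `p` is the code word of request `j` for `c` and `x`. -/
def CodingWitness (G : BinStr × BinStr × ℕ → BinStr × BinStr → ℕ) (cU cH : Code)
    (ps : BinStr × BinStr) (w : ℕ) : Prop :=
  let oU := Code.evaln w.unpair.2.unpair.1 cU (encode (ps.1.take w.unpair.1, ([] : BinStr)))
  let oH := Code.evaln w.unpair.2.unpair.1 cH (encode ps.2)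
  oU.isSome = true ∧ oH.isSome = true ∧
    IsCodeword (Request G (strToNat (decodeStr (oU.getD 0))) (decodeStr (oH.getD 0))) requestLen
      w.unpair.2.unpair.2 (ps.1.drop w.unpair.1)

lemma primrecRel_codingWitness {G : BinStr × BinStr × ℕ → BinStr × BinStr → ℕ} (hG : Primrec₂ G)
    (cU cH : Code) : PrimrecRel (CodingWitness G cU cH) := by
  have hw : Primrec fun a : (BinStr × BinStr) × ℕ => a.2 := Primrec.snd
  have hp : Primrec fun a : (BinStr × BinStr) × ℕ => a.1.1 := Primrec.fst.comp Primrec.fst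
  have hs : Primrec fun a : (BinStr × BinStr) × ℕ => a.1.2 := Primrec.snd.comp Primrec.fst
  have hn := primrec_unpair_fst hw
  have hu := primrec_unpair_fst (primrec_unpair_snd hw)
  have hj := primrec_unpair_snd (primrec_unpair_snd hw)
  have hoU : Primrec fun a : (BinStr × BinStr) × ℕ => Code.evaln a.2.unpair.2.unpair.1 cU
      (encode (a.1.1.take a.2.unpair.1, ([] : BinStr))) :=
    Code.primrec_evaln.comp (Primrec.pair (Primrec.pair hu (Primrec.const cU))
      (Primrec.encode.comp (Primrec.pair (Primrec.list_take.comp hn hp) (Primrec.const []))))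
  have hoH : Primrec fun a : (BinStr × BinStr) × ℕ => Code.evaln a.2.unpair.2.unpair.1 cH
      (encode a.1.2) :=
    Code.primrec_evaln.comp (Primrec.pair (Primrec.pair hu (Primrec.const cH))
      (Primrec.encode.comp hs))
  refine (Primrec.eq.comp (Primrec.option_isSome.comp hoU) (Primrec.const true)).and
    ((Primrec.eq.comp (Primrec.option_isSome.comp hoH) (Primrec.const true)).and ?_)
  exact primrecPred_isCodeword hG
    (primrec_strToNat.comp (primrec_decodeStr.comp (Primrec.option_getD.comp hoU
      (Primrec.const 0))))
    (primrec_decodeStr.comp (Primrec.option_getD.comp hoH (Primrec.const 0))) hj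
    (Primrec.list_drop.comp hn hp)

open Classical in
/-- The coding machine: it searches for a witness and prints the target of the request found. -/
noncomputable def codingMachine (G : BinStr × BinStr × ℕ → BinStr × BinStr → ℕ) (cU cH : Code)
    (p s : BinStr) : Part BinStr :=
  (Nat.rfind fun w => Part.some (decide (CodingWitness G cU cH (p, s) w))).map
    fun w => decodeStr w.unpair.2.unpair.2.unpair.1

/-- `c` is a program for the partial function `f` on code numbers. -/
def IsCodeFor {α : Type} [Encodable α] (c : Code) (f : α →. BinStr) : Prop :=
  ∀ a, c.eval (encode a) = (f a).map encode

lemma exists_isCodeFor {α : Type} [Primcodable α] {f : α →. BinStr} (hf : Partrec f) :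
    ∃ c, IsCodeFor c f := by
  obtain ⟨c, hc⟩ := Code.exists_code.1 hf
  exact ⟨c, fun a => by simp [hc]⟩

lemma IsCodeFor.mem_of_evaln {α : Type} [Encodable α] {c : Code} {f : α →. BinStr}
    (h : IsCodeFor c f) {u : ℕ} {a : α} (hs : (Code.evaln u c (encode a)).isSome = true) :
    decodeStr ((Code.evaln u c (encode a)).getD 0) ∈ f a := by
  obtain ⟨v, hv⟩ := Option.isSome_iff_exists.1 hs
  have h1 := Code.evaln_sound (Option.mem_def.2 hv)
  rw [h, Part.mem_map_iff] at h1
  obtain ⟨b, hb, rfl⟩ := h1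
  simpa [hv, decodeStr] using hb

lemma IsCodeFor.exists_evaln {α : Type} [Encodable α] {c : Code} {f : α →. BinStr}
    (h : IsCodeFor c f) {a : α} {b : BinStr} (hb : b ∈ f a) :
    ∃ u₀, ∀ u, u₀ ≤ u → Code.evaln u c (encode a) = some (encode b) := by
  have h1 : encode b ∈ c.eval (encode a) := by
    rw [h]
    exact Part.mem_map _ hb
  obtain ⟨u₀, hu₀⟩ := Code.evaln_complete.1 h1
  exact ⟨u₀, fun u hu => Code.evaln_mono hu hu₀⟩

variable {U : BinStr → BinStr →. BinStr} {H : BinStr →. BinStr}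
  {G : BinStr × BinStr × ℕ → BinStr × BinStr → ℕ} {cU cH : Code}

/-- Witnesses for comparable programs agree on the program and on the request: the headers read by
`U` coincide because `U` is a prefix machine, and then so do the code words. -/
lemma CodingWitness.eq_of_prefix (hU : IsPrefixMachine U)
    (hcU : IsCodeFor cU fun a : BinStr × BinStr => U a.1 a.2) (hcH : IsCodeFor cH H)
    {p p' s : BinStr} {w w' : ℕ} (h : CodingWitness G cU cH (p, s) w)
    (h' : CodingWitness G cU cH (p', s) w') (hpp : p <+: p') :
    w.unpair.2.unpair.2 = w'.unpair.2.unpair.2 ∧ p = p' := by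
  obtain ⟨a1, a2, a3⟩ := h
  obtain ⟨b1, b2, b3⟩ := h'
  have hA := hcU.mem_of_evaln a1
  have hB := hcU.mem_of_evaln b1
  have hA' := hcH.mem_of_evaln a2
  have hB' := hcH.mem_of_evaln b2
  rw [Part.mem_unique hA' hB'] at a3
  have hpre : p.take w.unpair.1 = p'.take w'.unpair.1 := by
    have e1 := (List.take_prefix w.unpair.1 p).trans hpp
    have e2 := List.take_prefix w'.unpair.1 p'
    rcases List.prefix_or_prefix_of_prefix e1 e2 with e | e
    · exact hU.prefix_free [] _ _ (Part.dom_iff_mem.2 ⟨_, hA⟩) (Part.dom_iff_mem.2 ⟨_, hB⟩) e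
    · exact (hU.prefix_free [] _ _ (Part.dom_iff_mem.2 ⟨_, hB⟩)
        (Part.dom_iff_mem.2 ⟨_, hA⟩) e).symm
  simp only [hpre] at hA a3
  rw [Part.mem_unique hA hB] at a3
  have hq : p.drop w.unpair.1 <+: p'.drop w'.unpair.1 := by
    have := hpp
    rw [← List.take_append_drop w.unpair.1 p, ← List.take_append_drop w'.unpair.1 p', hpre] at this
    exact (List.prefix_append_right_inj _).1 this
  obtain ⟨hj, hqe⟩ := a3.eq_of_prefix requestLen_le b3 hq
  refine ⟨hj, ?_⟩
  rw [← List.take_append_drop w.unpair.1 p, ← List.take_append_drop w'.unpair.1 p', hpre]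
  exact congrArg _ hqe

lemma exists_witness_of_dom {p s : BinStr} (h : (codingMachine G cU cH p s).Dom) :
    ∃ w, CodingWitness G cU cH (p, s) w := by
  classical
  obtain ⟨y, hy⟩ := Part.dom_iff_mem.1 h
  obtain ⟨w, hw, -⟩ := (Part.mem_map_iff _).1 hy
  have := Nat.rfind_spec hw
  exact ⟨w, by simpa using this⟩

lemma mem_codingMachine (hU : IsPrefixMachine U)
    (hcU : IsCodeFor cU fun a : BinStr × BinStr => U a.1 a.2) (hcH : IsCodeFor cH H)
    {p s : BinStr} {w : ℕ} (h : CodingWitness G cU cH (p, s) w) :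
    decodeStr w.unpair.2.unpair.2.unpair.1 ∈ codingMachine G cU cH p s := by
  classical
  obtain ⟨w', hw', -⟩ := Nat.rfind_min'
    (p := fun w => decide (CodingWitness G cU cH (p, s) w)) (m := w) (by simpa using h)
  have h' : CodingWitness G cU cH (p, s) w' := by simpa using Nat.rfind_spec hw'
  rw [(CodingWitness.eq_of_prefix hU hcU hcH h h' List.prefix_rfl).1]
  exact (Part.mem_map_iff _).2 ⟨w', hw', rfl⟩

lemma isPrefixMachine_codingMachine (hU : IsPrefixMachine U)
    (hcU : IsCodeFor cU fun a : BinStr × BinStr => U a.1 a.2) (hcH : IsCodeFor cH H)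
    (hG : Primrec₂ G) : IsPrefixMachine (codingMachine G cU cH) := by
  classical
  refine ⟨?_, fun s p q hp hq hpq => ?_⟩
  · have h1 : Partrec fun a : BinStr × BinStr => Nat.rfind fun w =>
        Part.some (decide (CodingWitness G cU cH a w)) :=
      Partrec.rfind (p := fun a w => Part.some (decide (CodingWitness G cU cH a w)))
        (primrecRel_codingWitness hG cU cH).decide.to_comp.partrec
    have hw : Primrec fun a : (BinStr × BinStr) × ℕ => a.2 := Primrec.snd
    exact h1.map (primrec_decodeStr.comp (primrec_unpair_fst (primrec_unpair_snd
      (primrec_unpair_snd hw)))).to₂.to_comp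
  · obtain ⟨w, hw⟩ := exists_witness_of_dom hp
    obtain ⟨w', hw'⟩ := exists_witness_of_dom hq
    exact (CodingWitness.eq_of_prefix hU hcU hcH hw hw' hpq).2

lemma condK_le {x y p : BinStr} (h : x ∈ U p y) : condK U x y ≤ p.length :=
  Nat.sInf_le ⟨p, h, rfl⟩

/-- A universal prefix machine can print any given string. -/
lemma exists_program (hU : IsUniversalPrefixMachine U) (x y : BinStr) : ∃ p, x ∈ U p y := by
  classical
  let T : BinStr → BinStr →. BinStr := fun p _ => if p = [] then Part.some x else Part.none
  have hT : IsPrefixMachine T := by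
    refine ⟨?_, fun y p q hp hq _ => ?_⟩
    · refine (Partrec.cond (c := fun a : BinStr × BinStr => decide (a.1 = []))
        (f := fun _ => Part.some x) (g := fun _ => Part.none)
        (Primrec.eq.comp Primrec.fst (Primrec.const [])).decide.to_comp
        (Computable.const x).partrec Partrec.none).of_eq fun a => ?_
      by_cases h : a.1 = [] <;> simp [T, h]
    · have hnil : ∀ p, (T p y).Dom → p = [] := fun p hp => by
        by_contra h
        simp [T, h] at hp
      rw [hnil p hp, hnil q hq]
  obtain ⟨h, hh⟩ := hU.simulates T hT
  exact ⟨h ++ [], by rw [hh]; simp [T]⟩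

lemma exists_program_length_eq (hU : IsUniversalPrefixMachine U) (x y : BinStr) :
    ∃ p, x ∈ U p y ∧ p.length = condK U x y := by
  obtain ⟨p, hp⟩ := exists_program hU x y
  exact Nat.sInf_mem (s := {n | ∃ p : BinStr, x ∈ U p y ∧ p.length = n}) ⟨_, p, hp, rfl⟩

/-- Coding theorem: if the requests that the program `c` generates from the side information `s`
fit into the unit interval, then each verified request `(y, k)` gives a description of `y` of
length `k`, up to the complexity of `c` and a constant. -/
theorem condK_le_of_verified (hU : IsUniversalPrefixMachine U) (hH : Partrec H)
    (hG : Primrec₂ G) :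
    ∃ C : ℕ, ∀ (c : ℕ) (x y s : BinStr) (k : ℕ), x ∈ H s →
      (∀ n, allocated (Request G c x) requestLen n ≤ 1) → (∃ t, Verified c (G (x, y, k)) t) →
        condK U y s ≤ k + prefixK U (natToStr c) + C := by
  classical
  obtain ⟨cU, hcU⟩ := exists_isCodeFor hU.partrec
  obtain ⟨cH, hcH⟩ := exists_isCodeFor hH
  obtain ⟨h, hh⟩ := hU.simulates _
    (isPrefixMachine_codingMachine hU.toIsPrefixMachine hcU hcH hG)
  refine ⟨h.length + 2, fun c x y s k hx hS hv => ?_⟩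
  obtain ⟨p, hp, hpl⟩ := exists_program_length_eq hU (natToStr c) []
  set j := Nat.pair (encode y) (Nat.pair k (Nat.find hv)) with hj
  have hjy : decodeStr (encode y) = y := by simp [decodeStr]
  have hreq : Request G c x j := by
    simp only [Request, hj, Nat.unpair_pair, hjy, true_and]
    exact ⟨Nat.find_spec hv, fun t ht => Nat.find_min hv ht⟩
  obtain ⟨q, hq⟩ := exists_codeword requestLen_le hreq (hS _)
  obtain ⟨u₁, hu₁⟩ := hcU.exists_evaln (a := (p, ([] : BinStr))) hp
  obtain ⟨u₂, hu₂⟩ := hcH.exists_evaln hx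
  have hw : CodingWitness G cU cH (p ++ q, s) (Nat.pair p.length (Nat.pair (max u₁ u₂) j)) := by
    simp only [CodingWitness, Nat.unpair_pair, List.take_left', List.drop_left',
      hu₁ _ (le_max_left _ _), hu₂ _ (le_max_right _ _)]
    simpa [decodeStr, strToNat_natToStr] using hq
  have hm := mem_codingMachine hU.toIsPrefixMachine hcU hcH hw
  rw [← hh] at hm
  simp only [Nat.unpair_pair, hj, hjy] at hm
  refine (condK_le hm).trans ?_
  have hql := hq.2.1
  simp only [requestLen, hj, Nat.unpair_pair] at hql
  simp only [List.length_append, hql, hpl, prefixK]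
  omega

end CodingMachine

section SemimeasureCoding

/-! ### Which requests are verified -/

variable {f : BinStr × BinStr → ℝ} {c : Code}

lemma lowerEstimate_le (hc : ComputesReal c f) (hf : ∀ z, 0 ≤ f z) (z : BinStr × BinStr)
    {M : ℕ} (hM : 0 < M) (u : ℕ) :
    (lowerEstimate (encode c) (encode z) M u : ℝ) ≤ M * f z := by
  have hM' : (0 : ℝ) < M := by exact_mod_cast hM
  obtain ⟨p, q, b, he, hq, hpq, -⟩ := hc z M hM
  rw [abs_of_nonneg (hf z), abs_lt, lt_div_iff₀ hM'] at hpq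
  rw [lowerEstimate, Denumerable.ofNat_encode]
  cases hev : Code.evaln u c (Nat.pair (encode z) M) with
  | none => simpa using mul_nonneg hM'.le (hf z)
  | some v =>
    have hv := Code.evaln_sound (Option.mem_def.2 hev)
    rw [he, Part.mem_some_iff] at hv
    subst hv
    simp only [Option.map_some, Nat.unpair_pair, Option.getD_some]
    rcases Nat.eq_zero_or_pos (M * p / q) with h0 | h0
    · simpa [h0] using mul_nonneg hM'.le (hf z)
    · have h1 : ((M * p / q : ℕ) : ℝ) ≤ M * (p / q) := by
        refine Nat.cast_div_le.trans_eq ?_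
        push_cast
        ring
      rw [Nat.cast_sub h0]
      push_cast
      nlinarith

lemma exists_lt_lowerEstimate (hc : ComputesReal c f) (hf : ∀ z, 0 ≤ f z)
    (z : BinStr × BinStr) {M : ℕ} (hM : 0 < M) :
    ∃ u₀, ∀ u, u₀ ≤ u → M * f z - 3 < lowerEstimate (encode c) (encode z) M u := by
  have hM' : (0 : ℝ) < M := by exact_mod_cast hM
  obtain ⟨p, q, b, he, hq, hpq, -⟩ := hc z M hM
  rw [abs_of_nonneg (hf z), abs_lt, neg_lt, lt_div_iff₀ hM', lt_div_iff₀ hM'] at hpq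
  obtain ⟨u₀, hu₀⟩ := Code.evaln_complete.1 (he ▸ Part.mem_some _)
  refine ⟨u₀, fun u hu => ?_⟩
  have hev := Code.evaln_mono hu hu₀
  rw [Option.mem_def] at hev
  rw [lowerEstimate, Denumerable.ofNat_encode, hev]
  simp only [Option.map_some, Nat.unpair_pair, Option.getD_some]
  have h1 : (M : ℝ) * (p / q) < ((M * p / q : ℕ) : ℝ) + 1 := by
    rw [← Nat.floor_div_eq_div (K := ℝ)]
    push_cast
    rw [← mul_div_assoc]
    exact Nat.lt_floor_add_one _
  have h2 : ((M * p / q : ℕ) : ℝ) ≤ ((M * p / q - 1 : ℕ) : ℝ) + 1 := by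
    exact_mod_cast (by omega : M * p / q ≤ M * p / q - 1 + 1)
  nlinarith [hpq.1]

/-- Lower semicomputability: the condition `∑ g z * f z > 1` is verified at some stage if and only
if it is true. -/
lemma exists_verified_iff (hc : ComputesReal c f) (hf : ∀ z, 0 ≤ f z) {g : BinStr × BinStr → ℕ}
    {S : ℝ} (hS : HasSum (fun z => g z * f z) S) :
    (∃ t, Verified (encode c) g t) ↔ 1 < S := by
  let F : ℕ → ℝ := fun n => ((decode₂ (BinStr × BinStr) n).map f).getD 0
  have hF : ∀ n, 0 ≤ F n := fun n => by
    cases h : decode₂ (BinStr × BinStr) n <;> simp [F, h, hf]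
  have hsum : HasSum (fun n => (codeWeight g n : ℝ) * F n) S := by
    rw [← (encode_injective (α := BinStr × BinStr)).hasSum_iff (f := fun n : ℕ =>
      (codeWeight g n : ℝ) * F n)]
    · simpa [Function.comp_def, codeWeight, F] using hS
    · intro n hn
      have : decode₂ (BinStr × BinStr) n = none := by
        by_contra h
        exact hn (decode₂_ne_none_iff.1 h)
      simp [F, this]
  constructor
  · rintro ⟨t, ht⟩
    rw [Verified] at ht
    set M := t.unpair.1
    -- At precision zero every estimate is `0 - 1 = 0`, so nothing is verified.
    have hM : 0 < M := by
      by_contra h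
      have h0 : M = 0 := by omega
      rw [h0] at ht
      refine absurd ht (not_lt.2 (le_of_eq (Finset.sum_eq_zero fun n _ => ?_)))
      rw [lowerEstimate]
      cases Code.evaln t.unpair.2.unpair.1 (Denumerable.ofNat Code (encode c))
        (Nat.pair n 0) <;> simp
    have hM' : (0 : ℝ) < M := by exact_mod_cast hM
    have h1 : (M : ℝ) < ∑ n ∈ Finset.range t.unpair.2.unpair.2, M * (codeWeight g n * F n) := by
      have ht' : (M : ℝ) < _ := Nat.cast_lt.2 ht
      push_cast at ht'
      refine ht'.trans_le (Finset.sum_le_sum fun n _ => ?_)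
      cases h : decode₂ (BinStr × BinStr) n with
      | none => simp [codeWeight, h]
      | some z =>
        have hz := decode₂_eq_some.1 h
        subst hz
        have := lowerEstimate_le hc hf z hM t.unpair.2.unpair.1
        simp only [F, h, Option.map_some, Option.getD_some]
        calc _ ≤ (codeWeight g (encode z) : ℝ) * (M * f z) := by gcongr
          _ = _ := by ring
    rw [← Finset.mul_sum] at h1
    have h2 := sum_le_hasSum (Finset.range t.unpair.2.unpair.2)
      (fun n _ => mul_nonneg (Nat.cast_nonneg _) (hF n)) hsum
    by_contra hcon
    push Not at hcon
    nlinarith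
  · intro h1
    obtain ⟨N, hN⟩ := ((hsum.tendsto_sum_nat).eventually (lt_mem_nhds h1)).exists
    set A := ∑ n ∈ Finset.range N, (codeWeight g n : ℝ) * F n with hA
    set B := ∑ n ∈ Finset.range N, (codeWeight g n : ℝ) with hB
    -- The precision `M` makes the error `3 * B` smaller than `M * (A - 1)`.
    obtain ⟨M, hM⟩ := exists_nat_gt (3 * B / (A - 1))
    have hB0 : 0 ≤ B := Finset.sum_nonneg fun n _ => Nat.cast_nonneg _
    have hM' : (0 : ℝ) < M := lt_of_le_of_lt (div_nonneg (by positivity) (by linarith)) hM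
    rw [div_lt_iff₀ (by linarith)] at hM
    have hu : ∀ n, ∃ u₀, ∀ u, u₀ ≤ u →
        (codeWeight g n : ℝ) * (M * F n - 3) ≤
          codeWeight g n * lowerEstimate (encode c) n M u := fun n => by
      cases h : decode₂ (BinStr × BinStr) n with
      | none => exact ⟨0, fun u _ => by simp [codeWeight, h]⟩
      | some z =>
        have hz := decode₂_eq_some.1 h
        subst hz
        obtain ⟨u₀, hu₀⟩ := exists_lt_lowerEstimate hc hf z (M := M) (by exact_mod_cast hM')
        refine ⟨u₀, fun u hu => ?_⟩
        simp only [F, h, Option.map_some, Option.getD_some]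
        exact mul_le_mul_of_nonneg_left (hu₀ u hu).le (Nat.cast_nonneg _)
    choose u₀ hu₀ using hu
    refine ⟨Nat.pair M (Nat.pair ((Finset.range N).sup u₀) N), ?_⟩
    simp only [Verified, Nat.unpair_pair]
    have h2 : (∑ n ∈ Finset.range N, (codeWeight g n : ℝ) * (M * F n - 3)) ≤
        ∑ n ∈ Finset.range N, (codeWeight g n : ℝ) *
          lowerEstimate (encode c) n M ((Finset.range N).sup u₀) :=
      Finset.sum_le_sum fun n hn => hu₀ n _ (Finset.le_sup hn)
    have h3 : (∑ n ∈ Finset.range N, (codeWeight g n : ℝ) * (M * F n - 3)) = M * A - 3 * B := by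
      rw [hA, hB, Finset.mul_sum, Finset.mul_sum, ← Finset.sum_sub_distrib]
      exact Finset.sum_congr rfl fun n _ => by ring
    have h4 : (M : ℝ) < ∑ n ∈ Finset.range N, (codeWeight g n : ℝ) *
          lowerEstimate (encode c) n M ((Finset.range N).sup u₀) := by linarith
    exact_mod_cast h4

/-! ### Coding with respect to a semimeasure -/

lemma sum_half_pow_le_min (K : ℕ) (a : ℝ) (ha : 0 ≤ a) :
    (∑ k ∈ Finset.range K, if (1 / 2 : ℝ) ^ k < a then (1 / 2 : ℝ) ^ (k + 1) else 0)
      ≤ min a 1 := by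
  induction K generalizing a with
  | zero => simp [ha]
  | succ K ih =>
    have h := ih (2 * a) (by linarith)
    have hshift : (∑ k ∈ Finset.range K,
        if (1 / 2 : ℝ) ^ (k + 1) < a then (1 / 2 : ℝ) ^ (k + 1 + 1) else 0)
        = 1 / 2 * ∑ k ∈ Finset.range K,
          if (1 / 2 : ℝ) ^ k < 2 * a then (1 / 2 : ℝ) ^ (k + 1) else 0 := by
      rw [Finset.mul_sum]
      refine Finset.sum_congr rfl fun k _ => ?_
      have hiff : (1 / 2 : ℝ) ^ (k + 1) < a ↔ (1 / 2 : ℝ) ^ k < 2 * a := by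
        rw [pow_succ]
        constructor <;> intro h <;> linarith
      simp only [hiff]
      split_ifs
      · ring
      · simp
    rw [Finset.sum_range_succ', hshift]
    have h1 := h.trans (min_le_left _ _)
    have h2 := h.trans (min_le_right _ _)
    split_ifs with h0
    · simp only [pow_zero] at h0
      refine le_min ?_ ?_ <;> norm_num <;> linarith
    · simp only [pow_zero, not_lt] at h0
      refine le_min ?_ ?_ <;> linarith

/-- For each `y` the granted requests ask for `2 ^ (-k-1)`, at most once for each `k` with
`2 ^ (-k) < w y`, which is at most `w y` altogether. -/
lemma allocated_request_le_one {G : BinStr × BinStr × ℕ → BinStr × BinStr → ℕ} {c : ℕ}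
    {x : BinStr} {w : BinStr → ℝ} (hw : ∀ y, 0 ≤ w y) (hw1 : ∀ Y : Finset BinStr, ∑ y ∈ Y, w y ≤ 1)
    (hv : ∀ y k, (∃ t, Verified c (G (x, y, k)) t) → (1 / 2 : ℝ) ^ k < w y) (n : ℕ) :
    allocated (Request G c x) requestLen n ≤ 1 := by
  classical
  let φ : ℕ → BinStr × ℕ := fun j => (decodeStr j.unpair.1, j.unpair.2.unpair.1)
  let h : BinStr × ℕ → ℝ := fun a => if (1 / 2 : ℝ) ^ a.2 < w a.1 then (1 / 2) ^ (a.2 + 1) else 0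
  have h0 : ∀ a, 0 ≤ h a := fun a => by
    simp only [h]
    split_ifs <;> positivity
  set J := (Finset.range n).filter (Request G c x)
  have hinj : Set.InjOn φ J := by
    intro j hj j' hj' hφ
    obtain ⟨a1, a2, a3⟩ := (Finset.mem_filter.1 hj).2
    obtain ⟨b1, b2, b3⟩ := (Finset.mem_filter.1 hj').2
    simp only [φ, Prod.mk.injEq] at hφ
    rw [← hφ.1, ← hφ.2] at b2 b3
    have e1 : j.unpair.1 = j'.unpair.1 := by rw [← a1, ← b1, hφ.1]
    have e3 : j.unpair.2.unpair.2 = j'.unpair.2.unpair.2 := by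
      rcases lt_trichotomy j.unpair.2.unpair.2 j'.unpair.2.unpair.2 with hlt | heq | hgt
      · exact absurd a2 (b3 _ hlt)
      · exact heq
      · exact absurd b2 (a3 _ hgt)
    rw [← Nat.pair_unpair j, ← Nat.pair_unpair j', e1, ← Nat.pair_unpair j.unpair.2,
      ← Nat.pair_unpair j'.unpair.2, hφ.2, e3]
  set Y := (Finset.range n).image fun j => decodeStr j.unpair.1
  set K := (Finset.range n).sup fun j => j.unpair.2.unpair.1
  have hsub : J.image φ ⊆ Y ×ˢ Finset.range (K + 1) := by
    intro a ha
    obtain ⟨j, hj, rfl⟩ := Finset.mem_image.1 ha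
    have hj := (Finset.mem_filter.1 hj).1
    exact Finset.mem_product.2 ⟨Finset.mem_image_of_mem _ hj, Finset.mem_range.2
      (Nat.lt_succ_of_le (Finset.le_sup (f := fun j : ℕ => j.unpair.2.unpair.1) hj))⟩
  calc allocated (Request G c x) requestLen n
      = ∑ j ∈ J, h (φ j) := by
        rw [allocated, ← Finset.sum_filter]
        refine Finset.sum_congr (by congr) fun j hj => ?_
        obtain ⟨-, a2, -⟩ := (Finset.mem_filter.1 hj).2
        simp only [h, φ, hv _ _ ⟨_, a2⟩, if_true, requestLen]
    _ = ∑ a ∈ J.image φ, h a := (Finset.sum_image hinj).symm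
    _ ≤ ∑ a ∈ Y ×ˢ Finset.range (K + 1), h a :=
        Finset.sum_le_sum_of_subset_of_nonneg hsub fun a _ _ => h0 a
    _ = ∑ y ∈ Y, ∑ k ∈ Finset.range (K + 1), h (y, k) := Finset.sum_product _ _ _
    _ ≤ ∑ y ∈ Y, w y := Finset.sum_le_sum fun y _ =>
        (sum_half_pow_le_min (K + 1) (w y) (hw y)).trans (min_le_left _ _)
    _ ≤ 1 := hw1 Y

lemma exists_half_pow_lt {a : ℝ} (ha : 0 < a) (ha1 : a ≤ 1) :
    ∃ k : ℕ, (1 / 2 : ℝ) ^ k < a ∧ (k : ℝ) ≤ -Real.logb 2 a + 1 := by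
  have hlog : 0 ≤ -Real.logb 2 a := neg_nonneg.2 (Real.logb_nonpos one_lt_two ha.le ha1)
  refine ⟨⌊-Real.logb 2 a⌋₊ + 1, ?_, ?_⟩
  · have h := Nat.lt_floor_add_one (-Real.logb 2 a)
    rw [one_div, inv_pow, ← Real.rpow_natCast, ← Real.rpow_neg zero_le_two,
      ← Real.lt_logb_iff_rpow_lt one_lt_two ha]
    push_cast
    linarith
  · push_cast
    linarith [Nat.floor_le hlog]

/-- Coding theorem for a semimeasure `w` that the program `c` lets one approximate from below,
given the side information `s`. -/
theorem condK_le_neg_logb {U : BinStr → BinStr →. BinStr} (hU : IsUniversalPrefixMachine U)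
    {H : BinStr →. BinStr} (hH : Partrec H) {G : BinStr × BinStr × ℕ → BinStr × BinStr → ℕ}
    (hG : Primrec₂ G) :
    ∃ C : ℕ, ∀ (c : ℕ) (x s : BinStr) (w : BinStr → ℝ), x ∈ H s → (∀ y, 0 ≤ w y) →
      (∀ Y : Finset BinStr, ∑ y ∈ Y, w y ≤ 1) →
      (∀ y k, (∃ t, Verified c (G (x, y, k)) t) ↔ (1 / 2 : ℝ) ^ k < w y) → ∀ y, 0 < w y →
        (condK U y s : ℝ) ≤ -Real.logb 2 (w y) + prefixK U (natToStr c) + C := by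
  obtain ⟨C, hC⟩ := condK_le_of_verified hU hH hG
  refine ⟨C + 1, fun c x s w hx hw hw1 hv y hy => ?_⟩
  obtain ⟨k, hk, hkl⟩ := exists_half_pow_lt hy (by simpa using hw1 {y})
  have h := hC c x y s k hx (allocated_request_le_one hw hw1 fun y k => (hv y k).1) ((hv y k).2 hk)
  have h' : (condK U y s : ℝ) ≤ k + prefixK U (natToStr c) + C := by exact_mod_cast h
  push_cast
  linarith

end SemimeasureCoding

section KraftAndMarginals

/-! ### The Kraft inequality for conditional complexity -/

lemma uniquelyDecodable_of_prefixFree {S : Set BinStr} (h0 : [] ∉ S)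
    (hS : ∀ p ∈ S, ∀ q ∈ S, p <+: q → p = q) : InformationTheory.UniquelyDecodable S := by
  intro L₁
  induction L₁ with
  | nil =>
    rintro (_ | ⟨q, L₂⟩) - h2 he
    · rfl
    · simp only [List.flatten_nil, List.flatten_cons, List.nil_eq, List.append_eq_nil_iff] at he
      exact absurd (he.1 ▸ h2 q (by simp)) h0
  | cons p L₁ ih =>
    rintro (_ | ⟨q, L₂⟩) h1 h2 he
    · simp only [List.flatten_nil, List.flatten_cons, List.append_eq_nil_iff] at he
      exact absurd (he.1 ▸ h1 p (by simp)) h0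
    · simp only [List.flatten_cons] at he
      have hpq : p = q := by
        have e1 : p <+: p ++ L₁.flatten := List.prefix_append _ _
        have e2 : q <+: p ++ L₁.flatten := he ▸ List.prefix_append _ _
        rcases List.prefix_or_prefix_of_prefix e1 e2 with e | e
        · exact hS p (h1 p (by simp)) q (h2 q (by simp)) e
        · exact (hS q (h2 q (by simp)) p (h1 p (by simp)) e).symm
      subst hpq
      rw [ih L₂ (fun w hw => h1 w (by simp [hw])) (fun w hw => h2 w (by simp [hw]))
        (List.append_cancel_left he)]

lemma sum_half_pow_length_le_one {S : Finset BinStr}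
    (hS : ∀ p ∈ S, ∀ q ∈ S, p <+: q → p = q) : ∑ p ∈ S, (1 / 2 : ℝ) ^ p.length ≤ 1 := by
  by_cases h0 : [] ∈ S
  · have : S = {[]} := by
      refine Finset.eq_singleton_iff_unique_mem.2 ⟨h0, fun p hp => ?_⟩
      exact (hS [] h0 p hp List.nil_prefix).symm
    simp [this]
  · simpa using InformationTheory.kraft_mcmillan_inequality
      (uniquelyDecodable_of_prefixFree (S := (S : Set BinStr)) h0 hS)

variable {U : BinStr → BinStr →. BinStr}

lemma sum_half_pow_condK_le_one (hU : IsUniversalPrefixMachine U) (s : BinStr)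
    (Y : Finset BinStr) : ∑ y ∈ Y, (1 / 2 : ℝ) ^ condK U y s ≤ 1 := by
  classical
  choose p hp hpl using fun y => exists_program_length_eq hU y s
  have hinj : Function.Injective p := fun y y' h => by
    have h1 := hp y
    rw [h] at h1
    exact Part.mem_unique h1 (hp y')
  calc ∑ y ∈ Y, (1 / 2 : ℝ) ^ condK U y s = ∑ q ∈ Y.image p, (1 / 2 : ℝ) ^ q.length := by
        rw [Finset.sum_image hinj.injOn]
        simp only [hpl]
    _ ≤ 1 := by
        refine sum_half_pow_length_le_one fun q hq q' hq' hqq => ?_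
        obtain ⟨y, -, rfl⟩ := Finset.mem_image.1 hq
        obtain ⟨y', -, rfl⟩ := Finset.mem_image.1 hq'
        exact hU.prefix_free s _ _ (Part.dom_iff_mem.2 ⟨_, hp y⟩)
          (Part.dom_iff_mem.2 ⟨_, hp y'⟩) hqq

lemma summable_half_pow_condK (hU : IsUniversalPrefixMachine U) (s : BinStr) :
    Summable fun y => (1 / 2 : ℝ) ^ condK U y s :=
  summable_of_sum_le (fun _ => by positivity) (sum_half_pow_condK_le_one hU s)

lemma tsum_half_pow_condK_le_one (hU : IsUniversalPrefixMachine U) (s : BinStr) :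
    ∑' y, (1 / 2 : ℝ) ^ condK U y s ≤ 1 :=
  (summable_half_pow_condK hU s).tsum_le_of_sum_le (sum_half_pow_condK_le_one hU s)

/-- A machine may ignore its side information. -/
lemma condK_le_prefixK_add (hU : IsUniversalPrefixMachine U) :
    ∃ C : ℕ, ∀ y s, condK U y s ≤ prefixK U y + C := by
  have hT : IsPrefixMachine fun p _ => U p [] :=
    ⟨(Partrec₂.comp hU.partrec Computable.fst (Computable.const [])).to₂,
      fun _ p q hp hq h => hU.prefix_free [] p q hp hq h⟩
  obtain ⟨h, hh⟩ := hU.simulates _ hT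
  refine ⟨h.length, fun y s => ?_⟩
  obtain ⟨p, hp, hpl⟩ := exists_program_length_eq hU y []
  rw [← hh p s] at hp
  refine (condK_le hp).trans ?_
  rw [List.length_append, hpl, prefixK, add_comm]

lemma mem_shortestProgram (hU : IsUniversalPrefixMachine U) (x : BinStr) :
    x ∈ U (shortestProgram U x) [] := by
  have h : {p : BinStr | x ∈ U p []}.Nonempty := exists_program hU x []
  rw [shortestProgram, dif_pos h]
  exact WellFounded.min_mem _ _ h

/-! ### Marginals -/

variable {f : BinStr × BinStr → ℝ}

lemma IsJointPMF.hasSum_fst (hf : IsJointPMF f) (x : BinStr) :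
    HasSum (fun y => f (x, y)) (marginalFst f x) :=
  (hf.2.summable.prod_factor x).hasSum

lemma IsJointPMF.hasSum_marginalFst (hf : IsJointPMF f) : HasSum (marginalFst f) 1 :=
  hf.2.prod_fiberwise hf.hasSum_fst

lemma IsJointPMF.swap (hf : IsJointPMF f) : IsJointPMF (f ∘ Prod.swap) :=
  ⟨fun _ => hf.1 _, (Equiv.prodComm BinStr BinStr).hasSum_iff.2 hf.2⟩

lemma IsJointPMF.hasSum_snd (hf : IsJointPMF f) (y : BinStr) :
    HasSum (fun x => f (x, y)) (marginalSnd f y) :=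
  hf.swap.hasSum_fst y

lemma IsJointPMF.hasSum_marginalSnd (hf : IsJointPMF f) : HasSum (marginalSnd f) 1 :=
  hf.swap.hasSum_marginalFst

lemma IsJointPMF.le_marginalFst (hf : IsJointPMF f) (x y : BinStr) :
    f (x, y) ≤ marginalFst f x :=
  le_hasSum (hf.hasSum_fst x) y fun _ _ => hf.1 _

lemma IsJointPMF.le_marginalSnd (hf : IsJointPMF f) (x y : BinStr) :
    f (x, y) ≤ marginalSnd f y :=
  hf.swap.le_marginalFst y x

lemma IsJointPMF.marginalFst_nonneg (hf : IsJointPMF f) (x : BinStr) : 0 ≤ marginalFst f x :=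
  (hf.hasSum_fst x).nonneg fun _ => hf.1 _

lemma IsJointPMF.marginalSnd_nonneg (hf : IsJointPMF f) (y : BinStr) : 0 ≤ marginalSnd f y :=
  hf.swap.marginalFst_nonneg y

lemma IsJointPMF.hasSum_ite_fst (hf : IsJointPMF f) (x : BinStr) :
    HasSum (fun z : BinStr × BinStr => if z.1 = x then f z else 0) (marginalFst f x) := by
  rw [← (Prod.mk_right_injective x).hasSum_iff (f := fun z : BinStr × BinStr =>
    if z.1 = x then f z else 0)]
  · simpa [Function.comp_def] using hf.hasSum_fst x
  · rintro ⟨x', y⟩ hz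
    refine if_neg fun h => hz ⟨y, ?_⟩
    simp_all

lemma IsJointPMF.hasSum_ite_snd (hf : IsJointPMF f) (y : BinStr) :
    HasSum (fun z : BinStr × BinStr => if z.2 = y then f z else 0) (marginalSnd f y) :=
  (Equiv.prodComm BinStr BinStr).hasSum_iff.1 (hf.swap.hasSum_ite_fst y)

/-! ### Coding with the marginal and with the conditional distribution -/

/-- The weights for which `∑ G z * f z > 1` says that `2 ^ (-k) < f₂(y)`. -/
def marginalWeight (a : BinStr × BinStr × ℕ) (z : BinStr × BinStr) : ℕ :=
  if z.2 = a.2.1 then 2 ^ a.2.2 else 0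

/-- The weights for which `∑ G z * f z > 1` says that `2 ^ (-k) < f(x, y) / f₁(x)`: as `f` has
total mass one, the pairs with first component different from `x` have total mass
`1 - f₁(x)`, so that an upper estimate of `f₁(x)` becomes a lower estimate of a sum. -/
def conditionalWeight (a : BinStr × BinStr × ℕ) (z : BinStr × BinStr) : ℕ :=
  if z.1 = a.1 then (if z.2 = a.2.1 then 2 ^ a.2.2 else 0) else 1

lemma primrec_marginalWeight : Primrec₂ marginalWeight := by
  have ha : Primrec fun p : (BinStr × BinStr × ℕ) × (BinStr × BinStr) => p.1 := Primrec.fst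
  have hz : Primrec fun p : (BinStr × BinStr × ℕ) × (BinStr × BinStr) => p.2 := Primrec.snd
  exact Primrec.ite (Primrec.eq.comp (Primrec.snd.comp hz)
    (Primrec.fst.comp (Primrec.snd.comp ha)))
    (primrec_two_pow.comp (Primrec.snd.comp (Primrec.snd.comp ha))) (Primrec.const 0)

lemma primrec_conditionalWeight : Primrec₂ conditionalWeight := by
  have ha : Primrec fun p : (BinStr × BinStr × ℕ) × (BinStr × BinStr) => p.1 := Primrec.fst
  have hz : Primrec fun p : (BinStr × BinStr × ℕ) × (BinStr × BinStr) => p.2 := Primrec.snd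
  exact Primrec.ite (Primrec.eq.comp (Primrec.fst.comp hz) (Primrec.fst.comp ha))
    primrec_marginalWeight (Primrec.const 1)

lemma half_pow_lt_iff (k : ℕ) (a : ℝ) : (1 / 2 : ℝ) ^ k < a ↔ 1 < 2 ^ k * a := by
  rw [one_div, inv_pow, inv_lt_iff_one_lt_mul₀' (by positivity)]

/-- The coding bound `K(y) ≤ -log₂ f₂(y) + K(c) + O(1)`. -/
theorem prefixK_le_neg_logb_marginalSnd (hU : IsUniversalPrefixMachine U) :
    ∃ C : ℕ, ∀ (f : BinStr × BinStr → ℝ) (c : Code), IsJointPMF f → ComputesReal c f →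
      ∀ y, 0 < marginalSnd f y →
        (prefixK U y : ℝ) ≤ -Real.logb 2 (marginalSnd f y) + prefixK U (natToStr (encode c)) + C := by
  obtain ⟨C, hC⟩ := condK_le_neg_logb hU (H := fun _ => Part.some [])
    (Computable.const []).partrec primrec_marginalWeight
  refine ⟨C, fun f c hf hc => ?_⟩
  refine hC (encode c) [] [] (marginalSnd f) (Part.mem_some _) hf.marginalSnd_nonneg
    (fun Y => sum_le_hasSum Y (fun y _ => hf.marginalSnd_nonneg y) hf.hasSum_marginalSnd)
    fun y k => ?_
  rw [half_pow_lt_iff]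
  refine exists_verified_iff hc hf.1 ?_
  refine ((hf.hasSum_ite_snd y).mul_left (2 ^ k)).congr_fun fun z => ?_
  by_cases h : z.2 = y <;> simp [marginalWeight, h]

/-- The coding bound `K(y | x*) ≤ -log₂ (f(x, y) / f₁(x)) + K(c) + O(1)`. The machine runs `x*`
to obtain `x`. -/
theorem condK_shortestProgram_le_neg_logb (hU : IsUniversalPrefixMachine U) :
    ∃ C : ℕ, ∀ (f : BinStr × BinStr → ℝ) (c : Code), IsJointPMF f → ComputesReal c f →
      ∀ x y, 0 < f (x, y) →
        (condK U y (shortestProgram U x) : ℝ) ≤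
          -Real.logb 2 (f (x, y) / marginalFst f x) + prefixK U (natToStr (encode c)) + C := by
  obtain ⟨C, hC⟩ := condK_le_neg_logb hU (H := fun s => U s [])
    (Partrec₂.comp hU.partrec Computable.id (Computable.const [])) primrec_conditionalWeight
  refine ⟨C, fun f c hf hc x y hxy => ?_⟩
  have hx : 0 < marginalFst f x := hxy.trans_le (hf.le_marginalFst x y)
  refine hC (encode c) x _ (fun y => f (x, y) / marginalFst f x) (mem_shortestProgram hU x)
    (fun y => div_nonneg (hf.1 _) hx.le) (fun Y => ?_) (fun y k => ?_) y (div_pos hxy hx)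
  · rw [← Finset.sum_div, div_le_one hx]
    exact sum_le_hasSum Y (fun y _ => hf.1 _) (hf.hasSum_fst x)
  · have hS : HasSum (fun z => (conditionalWeight (x, y, k) z : ℝ) * f z)
        (2 ^ k * f (x, y) + (1 - marginalFst f x)) := by
      convert (hasSum_ite_eq (x, y) (2 ^ k * f (x, y))).add
        (hf.2.sub (hf.hasSum_ite_fst x)) using 2 with z
      obtain ⟨a, b⟩ := z
      by_cases ha : a = x <;> by_cases hb : b = y <;> simp [conditionalWeight, ha, hb]
    rw [exists_verified_iff hc hf.1 hS, half_pow_lt_iff, ← mul_div_assoc, one_lt_div hx]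
    constructor <;> intro h <;> linarith

end KraftAndMarginals

section Comparison

/-! ### Comparison of sums over pairs -/

lemma negTotal_ne_top {g h : BinStr × BinStr → ℝ} (hgh : ∀ z, -g z ≤ h z) (hh : Summable h) :
    negTotal g ≠ ⊤ :=
  ne_top_of_le_ne_top hh.tsum_ofReal_ne_top
    (ENNReal.tsum_le_tsum fun z => ENNReal.ofReal_le_ofReal (hgh z))

lemma tsum_ofReal_sub_tsum_ofReal_neg {h : BinStr × BinStr → ℝ} (hh : Summable h) :
    (∑' z, ENNReal.ofReal (h z)).toReal - (∑' z, ENNReal.ofReal (-h z)).toReal = ∑' z, h z := by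
  rw [ENNReal.tsum_toReal_eq fun _ => ENNReal.ofReal_ne_top,
    ENNReal.tsum_toReal_eq fun _ => ENNReal.ofReal_ne_top]
  have h1 := ENNReal.summable_toReal hh.tsum_ofReal_ne_top
  have h2 := ENNReal.summable_toReal hh.neg.tsum_ofReal_ne_top
  rw [← h1.tsum_sub h2]
  refine tsum_congr fun z => ?_
  rcases le_total 0 (h z) with hz | hz
  · rw [ENNReal.toReal_ofReal hz, ENNReal.ofReal_of_nonpos (by linarith)]
    simp
  · rw [ENNReal.toReal_ofReal (by linarith : 0 ≤ -h z), ENNReal.ofReal_of_nonpos hz]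
    simp

/-- Comparison of two sums with values in `(-∞, ∞]`, allowing a summable error. Parts are rearranged
in `ℝ≥0∞`, where no convergence has to be assumed. -/
lemma extSum_le_add {a b h : BinStr × BinStr → ℝ} {D : ℝ} (hab : ∀ z, a z ≤ b z + h z)
    (ha : negTotal a ≠ ⊤) (hb : negTotal b ≠ ⊤) (hh : Summable h) (hD : ∑' z, h z ≤ D) :
    extSum a ≤ extSum b + (D : EReal) := by
  set A := ∑' z, ENNReal.ofReal (a z) with hA
  set B := ∑' z, ENNReal.ofReal (b z) with hB
  set P := ∑' z, ENNReal.ofReal (h z) with hP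
  set N := ∑' z, ENNReal.ofReal (-h z) with hN
  have hPt : P ≠ ⊤ := hh.tsum_ofReal_ne_top
  have hNt : N ≠ ⊤ := hh.neg.tsum_ofReal_ne_top
  have key : A + negTotal b + N ≤ B + negTotal a + P := by
    simp only [hA, hB, hP, hN, negTotal, ← ENNReal.tsum_add]
    refine ENNReal.tsum_le_tsum fun z => ?_
    have e : ∀ r : ℝ, ENNReal.ofReal r = ENNReal.ofReal (max r 0) := fun r => by
      rcases le_total 0 r with hr | hr
      · rw [max_eq_left hr]
      · rw [max_eq_right hr, ENNReal.ofReal_of_nonpos hr, ENNReal.ofReal_zero]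
    simp only [e (a z), e (b z), e (h z), e (-a z), e (-b z), e (-h z)]
    have m : ∀ r : ℝ, 0 ≤ max r 0 := fun r => le_max_right _ _
    rw [← ENNReal.ofReal_add (m _) (m _), ← ENNReal.ofReal_add (add_nonneg (m _) (m _)) (m _),
      ← ENNReal.ofReal_add (m _) (m _), ← ENNReal.ofReal_add (add_nonneg (m _) (m _)) (m _)]
    refine ENNReal.ofReal_le_ofReal ?_
    have d : ∀ r : ℝ, max r 0 = r + max (-r) 0 := fun r => by
      rcases le_total 0 r with hr | hr
      · rw [max_eq_left hr, max_eq_right (by linarith), add_zero]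
      · rw [max_eq_right hr, max_eq_left (by linarith)]
        ring
    linarith [d (a z), d (b z), d (h z), hab z]
  have hPN := tsum_ofReal_sub_tsum_ofReal_neg hh
  rw [← hP, ← hN] at hPN
  have hcoe : ∀ x : ENNReal, x ≠ ⊤ → (x : EReal) = ((x.toReal : ℝ) : EReal) := fun x hx =>
    (EReal.coe_ennreal_toReal hx).symm
  by_cases hBt : B = ⊤
  · have : extSum b = ⊤ := by
      rw [extSum, ← hB, hBt, hcoe _ hb, EReal.coe_ennreal_top, EReal.top_sub_coe]
    rw [this, EReal.top_add_coe]
    exact le_top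
  · have hAt : A ≠ ⊤ := by
      have : A + negTotal b + N ≠ ⊤ := ne_top_of_le_ne_top
        (ENNReal.add_ne_top.2 ⟨ENNReal.add_ne_top.2 ⟨hBt, ha⟩, hPt⟩) key
      exact (ENNReal.add_ne_top.1 (ENNReal.add_ne_top.1 this).1).1
    have key' := ENNReal.toReal_mono
      (ENNReal.add_ne_top.2 ⟨ENNReal.add_ne_top.2 ⟨hBt, ha⟩, hPt⟩) key
    rw [ENNReal.toReal_add (ENNReal.add_ne_top.2 ⟨hAt, hb⟩) hNt, ENNReal.toReal_add hAt hb,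
      ENNReal.toReal_add (ENNReal.add_ne_top.2 ⟨hBt, ha⟩) hPt, ENNReal.toReal_add hBt ha] at key'
    rw [extSum, extSum, ← hA, ← hB, hcoe _ hAt, hcoe _ hBt, hcoe _ ha, hcoe _ hb,
      ← EReal.coe_sub, ← EReal.coe_sub, ← EReal.coe_add, EReal.coe_le_coe_iff]
    linarith

lemma summable_prod_of_tsum_le {q : BinStr × BinStr → ℝ} {r : BinStr → ℝ} {R : ℝ}
    (hq : ∀ z, 0 ≤ q z) (hq1 : ∀ x, Summable fun y => q (x, y))
    (hqr : ∀ x, ∑' y, q (x, y) ≤ r x) (hr : HasSum r R) : Summable q ∧ ∑' z, q z ≤ R := by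
  have h1 : Summable fun x => ∑' y, q (x, y) :=
    Summable.of_nonneg_of_le (fun x => tsum_nonneg fun y => hq _) hqr hr.summable
  have h2 : Summable q := (summable_prod_of_nonneg hq).2 ⟨hq1, h1⟩
  refine ⟨h2, ?_⟩
  rw [h2.tsum_prod' hq1, ← hr.tsum_eq]
  exact h1.tsum_le_tsum hqr hr.summable

/-! ### The noiseless coding inequalities -/

/-- The estimate `log₂ t ≤ (t - 1) / log 2` for `t = q / p`, scaled by `p`. -/
lemma mul_logb_div_le {p q : ℝ} (hp : 0 < p) (hq : 0 < q) :
    p * Real.logb 2 (q / p) ≤ (q - p) / Real.log 2 := by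
  have hL : 0 < Real.log 2 := Real.log_pos one_lt_two
  have h := Real.log_le_sub_one_of_pos (div_pos hq hp)
  rw [Real.logb, ← mul_div_assoc]
  gcongr
  calc p * Real.log (q / p) ≤ p * (q / p - 1) := by gcongr
    _ = q - p := by field_simp

lemma logb_half_pow (k : ℕ) : Real.logb 2 ((1 / 2 : ℝ) ^ k) = -k := by
  rw [one_div, inv_pow, Real.logb_inv, ← Real.rpow_natCast, Real.logb_rpow] <;> norm_num

variable {U : BinStr → BinStr →. BinStr} {f : BinStr × BinStr → ℝ}

lemma negTotal_shannonTerm_ne_top (hf : IsJointPMF f) : negTotal (shannonTerm f) ≠ ⊤ := by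
  have hL : 0 < Real.log 2 := Real.log_pos one_lt_two
  have hx : ∀ x, Summable fun y => marginalFst f x * marginalSnd f y := fun x =>
    hf.hasSum_marginalSnd.summable.mul_left (marginalFst f x)
  have hS : Summable fun z : BinStr × BinStr => marginalFst f z.1 * marginalSnd f z.2 :=
    (summable_prod_of_tsum_le (r := marginalFst f)
      (q := fun z : BinStr × BinStr => marginalFst f z.1 * marginalSnd f z.2)
      (fun z => mul_nonneg (hf.marginalFst_nonneg _) (hf.marginalSnd_nonneg _)) hx
      (fun x => ((hf.hasSum_marginalSnd.mul_left (marginalFst f x)).tsum_eq.trans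
        (mul_one _)).le)
      hf.hasSum_marginalFst).1
  refine negTotal_ne_top (h := fun z => marginalFst f z.1 * marginalSnd f z.2 / Real.log 2)
    (fun z => ?_) (hS.div_const _)
  obtain ⟨x, y⟩ := z
  rcases (hf.1 (x, y)).eq_or_lt with h0 | h0
  · simp only [shannonTerm, ← h0, zero_mul, neg_zero]
    exact div_nonneg (mul_nonneg (hf.marginalFst_nonneg _) (hf.marginalSnd_nonneg _)) hL.le
  · have h1 := h0.trans_le (hf.le_marginalFst x y)
    have h2 := h0.trans_le (hf.le_marginalSnd x y)
    have h3 := mul_logb_div_le h0 (mul_pos h1 h2)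
    rw [← inv_div, Real.logb_inv] at h3
    have h4 : (marginalFst f x * marginalSnd f y - f (x, y)) / Real.log 2 ≤
      marginalFst f x * marginalSnd f y / Real.log 2 := by gcongr; linarith
    simp only [shannonTerm]
    linarith

lemma negTotal_algTerm_ne_top (hU : IsUniversalPrefixMachine U) (hf : IsJointPMF f) :
    negTotal (algTerm U f) ≠ ⊤ := by
  obtain ⟨C, hC⟩ := condK_le_prefixK_add hU
  refine negTotal_ne_top (h := fun z => f z * C) (fun z => ?_) (hf.2.summable.mul_right _)
  have h : (condK U z.2 (shortestProgram U z.1) : ℝ) ≤ prefixK U z.2 + C := by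
    exact_mod_cast hC z.2 (shortestProgram U z.1)
  rw [algTerm, algMutualInfo, ← mul_neg]
  exact mul_le_mul_of_nonneg_left (by linarith) (hf.1 z)

/-- A bound on `K(y | x*)` by the conditional code length bounds the Shannon information by the
expected algorithmic information: the remaining term compares `K(y)` with the ideal code length
for `f₂`, and is nonnegative on average by the Kraft inequality. -/
lemma mutualInfo_le (hU : IsUniversalPrefixMachine U) (hf : IsJointPMF f) {D : ℝ}
    (hD : ∀ x y, 0 < f (x, y) → (condK U y (shortestProgram U x) : ℝ) ≤
      -Real.logb 2 (f (x, y) / marginalFst f x) + D) :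
    mutualInfo f ≤ expectedAlgMutualInfo U f + (D : EReal) := by
  have hL : 0 < Real.log 2 := Real.log_pos one_lt_two
  let q : BinStr × BinStr → ℝ := fun z =>
    f z.swap / marginalSnd f z.1 * (1 / 2) ^ prefixK U z.1
  have hq : ∀ z, 0 ≤ q z := fun z =>
    mul_nonneg (div_nonneg (hf.1 _) (hf.marginalSnd_nonneg _)) (by positivity)
  have hqs : ∀ y, HasSum (fun x => q (y, x))
      (marginalSnd f y / marginalSnd f y * (1 / 2) ^ prefixK U y) := fun y =>
    ((hf.hasSum_snd y).div_const _).mul_right _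
  obtain ⟨hqS, hq1⟩ := summable_prod_of_tsum_le (r := fun y => (1 / 2 : ℝ) ^ prefixK U y) hq
    (fun y => (hqs y).summable)
    (fun y => (hqs y).tsum_eq.trans_le
      (mul_le_of_le_one_left (by positivity) (div_self_le_one _)))
    (summable_half_pow_condK hU []).hasSum
  have hq1 := hq1.trans (tsum_half_pow_condK_le_one hU [])
  have hqS' : HasSum (fun z : BinStr × BinStr => q z.swap) (∑' z, q z) :=
    (Equiv.prodComm BinStr BinStr).hasSum_iff.2 hqS.hasSum
  have hh := (hf.2.mul_right D).add ((hqS'.sub hf.2).div_const (Real.log 2))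
  refine extSum_le_add (fun z => ?_) (negTotal_shannonTerm_ne_top hf)
    (negTotal_algTerm_ne_top hU hf) hh.summable ?_
  · obtain ⟨x, y⟩ := z
    rcases (hf.1 (x, y)).eq_or_lt with h0 | h0
    · simp [shannonTerm, algTerm, q, ← h0]
    · have h1 := h0.trans_le (hf.le_marginalFst x y)
      have h2 := h0.trans_le (hf.le_marginalSnd x y)
      have hK : (0 : ℝ) < (1 / 2) ^ prefixK U y := by positivity
      have h3 := mul_logb_div_le h0
        (mul_pos (div_pos h0 h2) hK)
      have e1 : f (x, y) / marginalSnd f y * (1 / 2) ^ prefixK U y / f (x, y)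
          = (1 / 2) ^ prefixK U y / marginalSnd f y := by field_simp
      rw [e1, Real.logb_div hK.ne' h2.ne', logb_half_pow] at h3
      have h4 := mul_le_mul_of_nonneg_left (hD x y h0) h0.le
      rw [Real.logb_div h0.ne' h1.ne'] at h4
      simp only [shannonTerm, algTerm, algMutualInfo, q, Prod.fst_swap, Prod.swap_swap]
      rw [Real.logb_div h0.ne' (mul_pos h1 h2).ne', Real.logb_mul h1.ne' h2.ne']
      linarith
  · rw [hh.tsum_eq, one_mul]
    have : (∑' z, q z - 1) / Real.log 2 ≤ 0 := div_nonpos_of_nonpos_of_nonneg (by linarith) hL.le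
    linarith

/-- A bound on `K(y)` by the ideal code length for `f₂` bounds the expected algorithmic information
by the Shannon information: the remaining term compares `K(y | x*)` with the conditional code
length, and for each `x` has the right sign on average by the Kraft inequality. -/
lemma expectedAlgMutualInfo_le (hU : IsUniversalPrefixMachine U) (hf : IsJointPMF f) {D : ℝ}
    (hD : ∀ y, 0 < marginalSnd f y →
      (prefixK U y : ℝ) ≤ -Real.logb 2 (marginalSnd f y) + D) :
    expectedAlgMutualInfo U f ≤ mutualInfo f + (D : EReal) := by
  have hL : 0 < Real.log 2 := Real.log_pos one_lt_two
  let q : BinStr × BinStr → ℝ := fun z =>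
    marginalFst f z.1 * (1 / 2) ^ condK U z.2 (shortestProgram U z.1)
  have hq : ∀ z, 0 ≤ q z := fun z => mul_nonneg (hf.marginalFst_nonneg _) (by positivity)
  have hqx : ∀ x, Summable fun y =>
      marginalFst f x * (1 / 2 : ℝ) ^ condK U y (shortestProgram U x) := fun x =>
    (summable_half_pow_condK hU _).mul_left (marginalFst f x)
  obtain ⟨hqS, hq1⟩ := summable_prod_of_tsum_le (r := marginalFst f) hq
    hqx
    (fun x => by
      simp only [q, tsum_mul_left]
      exact mul_le_of_le_one_right (hf.marginalFst_nonneg x) (tsum_half_pow_condK_le_one hU _))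
    hf.hasSum_marginalFst
  have hh := (hf.2.mul_right D).add ((hqS.hasSum.sub hf.2).div_const (Real.log 2))
  refine extSum_le_add (fun z => ?_) (negTotal_algTerm_ne_top hU hf)
    (negTotal_shannonTerm_ne_top hf) hh.summable ?_
  · obtain ⟨x, y⟩ := z
    rcases (hf.1 (x, y)).eq_or_lt with h0 | h0
    · simp only [shannonTerm, algTerm, ← h0, zero_mul, zero_add, sub_zero]
      exact div_nonneg (hq _) hL.le
    · have h1 := h0.trans_le (hf.le_marginalFst x y)
      have h2 := h0.trans_le (hf.le_marginalSnd x y)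
      have hK : (0 : ℝ) < (1 / 2) ^ condK U y (shortestProgram U x) := by positivity
      have h3 := mul_logb_div_le h0 (mul_pos h1 hK)
      rw [Real.logb_div (mul_pos h1 hK).ne' h0.ne', Real.logb_mul h1.ne' hK.ne',
        logb_half_pow] at h3
      have h4 := mul_le_mul_of_nonneg_left (hD y h2) h0.le
      simp only [shannonTerm, algTerm, algMutualInfo, q]
      rw [Real.logb_div h0.ne' (mul_pos h1 h2).ne', Real.logb_mul h1.ne' h2.ne']
      linarith
  · rw [hh.tsum_eq, one_mul]
    have : (∑' z, q z - 1) / Real.log 2 ≤ 0 := div_nonpos_of_nonpos_of_nonneg (by linarith) hL.le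
    linarith

lemma exists_computesReal_prefixK_eq_funK (hf : IsComputableReal f) :
    ∃ c : Code, ComputesReal c f ∧ prefixK U (natToStr (encode c)) = funK U f := by
  obtain ⟨c, hc⟩ := hf
  exact Nat.sInf_mem (s := {n | ∃ c : Code, ComputesReal c f ∧
    prefixK U (natToStr (encode c)) = n}) ⟨_, c, hc, rfl⟩

end Comparison

end AlgInfo

theorem mainTheorem5 (U : AlgInfo.BinStr → AlgInfo.BinStr →. AlgInfo.BinStr)
    (hU : AlgInfo.IsUniversalPrefixMachine U) :
    ∃ C : ℝ, ∀ f : AlgInfo.BinStr × AlgInfo.BinStr → ℝ,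
      AlgInfo.IsJointPMF f → AlgInfo.IsComputableReal f →
        AlgInfo.negTotal (AlgInfo.shannonTerm f) ≠ ⊤ ∧
        AlgInfo.negTotal (AlgInfo.algTerm U f) ≠ ⊤ ∧
        AlgInfo.mutualInfo f - ((AlgInfo.funK U f : ℝ) : EReal) ≤
          AlgInfo.expectedAlgMutualInfo U f + ((C : ℝ) : EReal) ∧
        AlgInfo.expectedAlgMutualInfo U f ≤
          AlgInfo.mutualInfo f + ((2 * (AlgInfo.funK U f : ℝ) : ℝ) : EReal) + ((C : ℝ) : EReal) := by
  obtain ⟨C₁, hC₁⟩ := AlgInfo.prefixK_le_neg_logb_marginalSnd hU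
  obtain ⟨C₂, hC₂⟩ := AlgInfo.condK_shortestProgram_le_neg_logb hU
  refine ⟨(C₁ : ℝ) + C₂, fun f hf hcomp => ⟨AlgInfo.negTotal_shannonTerm_ne_top hf,
    AlgInfo.negTotal_algTerm_ne_top hU hf, ?_, ?_⟩⟩
  · obtain ⟨c, hc, hcK⟩ := AlgInfo.exists_computesReal_prefixK_eq_funK (U := U) hcomp
    have h := AlgInfo.mutualInfo_le (D := (C₁ + C₂ : ℝ) + AlgInfo.funK U f) hU hf
      fun x y hxy => by
        have := hC₂ f c hf hc x y hxy
        rw [hcK] at this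
        linarith [Nat.cast_nonneg (α := ℝ) C₁]
    rw [EReal.coe_add, ← add_assoc] at h
    exact EReal.sub_le_of_le_add h
  · obtain ⟨c, hc, hcK⟩ := AlgInfo.exists_computesReal_prefixK_eq_funK (U := U) hcomp
    have h := AlgInfo.expectedAlgMutualInfo_le
      (D := 2 * (AlgInfo.funK U f : ℝ) + (C₁ + C₂ : ℝ)) hU hf
      fun y hy => by
        have := hC₁ f c hf hc y hy
        rw [hcK] at this
        linarith [Nat.cast_nonneg (α := ℝ) C₂, Nat.cast_nonneg (α := ℝ) (AlgInfo.funK U f)]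
    rwa [EReal.coe_add, ← add_assoc] at h
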